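/- Work in the category $\mathrm{Set}$. Let $\Sigma$ be an algebraic signature (a set $I$ of operation symbols with finite arities $n_i$), identified with the polynomial functor $\Sigma X=\coprod_{i\in I}X^{n_i}$. Let $(T,\eta,\mu)$ be the free monad over $\Sigma$ ($TX$ is the set of $\Sigma$-terms with variables in $X$), and let $\kappa_X\colon\Sigma TX\to TX$ be the term-forming algebra. Let $F\colon\mathrm{Set}\to\mathrm{Set}$ be a functor with a final coalgebra $(Z,\zeta)$, let $B$ be a set, and let $F^B$ be the functor $X\mapsto (FX)^B$, with a final coalgebra $(\bar Z,\bar\zeta)$. *Induced algebras.* For any functor $G\colon\mathrm{Set}\to\mathrm{Set}$, a natural transformation $\lambda\colon\Sigma G\Rightarrow GT$ (a monadic specification) induces a distributive law $\rho\colon TG\Rightarrow GT$ of the monad $T$ over $G$, namely the unique one with $\rho\circ\kappa_G\circ\Sigma\eta_G=\lambda$; explicitly, $\rho_X\colon TGX\to GTX$ is the homomorphism from $\kappa_{GX}$ to the $\Sigma$-algebra $G\mu_X\circ\lambda_{TX}$ that extends $G\eta_X$. If $(W,w)$ is a final $G$-coalgebra, let $[\![-]\!]\colon TW\to W$ be the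 unique coalgebra morphism to $(W,w)$ from the coalgebra $\rho_W\circ Tw\colon TW\to GTW$. The algebra induced by $\lambda$ is $[\![-]\!]\circ\kappa_W\circ\Sigma\eta_W\colon\Sigma W\to W$. *Strength and costrength.* For a functor $G\colon\mathrm{Set}\to\mathrm{Set}$ and sets $A,X$, the strength $\mathsf{st}^G_{A,X}\colon A\times GX\to G(A\times X)$ is $\mathsf{st}^G_{A,X}(a,t)=G(x\mapsto(a,x))(t)$, and the costrength $\mathsf{cs}^G_{A,X}\colon G(X^A)\to(GX)^A$ is $\mathsf{cs}^G_{A,X}(t)(a)=G(f\mapsto f(a))(t)$. Given $\lambda\colon\Sigma F\Rightarrow FT$, define $\bar\lambda\colon\Sigma F^B\Rightarrow F^BT$ by $$\bar\lambda_X=\bigl(\Sigma((FX)^B)\xrightarrow{\ \mathsf{cs}^\Sigma_{B,FX}\ }(\Sigma FX)^B\xrightarrow{\ (\lambda_X)^B\ }(FTX)^B\bigr).$$ *Pointwise extension.* Let $B^\omega$ be the set of infinite sequences over $B$, with head $\mathsf{hd}$ and tail $\mathsf{tl}$. Let $\mathsf{ev}\colon B^\omega\times\bar Z\to Z$ be the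 unique $F$-coalgebra morphism to $(Z,\zeta)$ from the $F$-coalgebra on $B^\omega\times\bar Z$ given by $(\beta,z)\mapsto\mathsf{st}^F_{B^\omega,\bar Z}\bigl(\mathsf{tl}(\beta),\ \bar\zeta(z)(\mathsf{hd}(\beta))\bigr)$. An algebra $\bar\sigma\colon\Sigma\bar Z\to\bar Z$ is a pointwise extension of $\sigma\colon\Sigma Z\to Z$ if $$\mathsf{ev}\circ(\mathrm{id}_{B^\omega}\times\bar\sigma)=\sigma\circ\Sigma\mathsf{ev}\circ\mathsf{st}^\Sigma_{B^\omega,\bar Z}\colon\ B^\omega\times\Sigma\bar Z\to Z.$$ **Theorem.** For every monadic specification $\lambda\colon\Sigma F\Rightarrow FT$, the algebra $\bar\sigma\colon\Sigma\bar Z\to\bar Z$ induced by $\bar\lambda$ is a pointwise extension of the algebra $\sigma\colon\Sigma Z\to Z$ induced by $\lambda$. -/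

import Mathlib

open CategoryTheory

universe u

namespace CoalgExt

/-! ### Signatures, terms and the free monad -/

/-- An algebraic signature: a set of operation symbols, each with a finite arity. -/
structure AlgSig where
  /-- The operation symbols. -/
  Op : Type u
  /-- The arity of an operation symbol. -/
  arity : Op → ℕ

namespace AlgSig

/-- The polynomial functor `Σ X = ∐ i, X ^ (arity i)` of a signature. -/
def functor (S : AlgSig.{u}) : Type u ⥤ Type u where
  obj X := (i : S.Op) × (Fin (S.arity i) → X)
  map g := TypeCat.ofHom fun t => ⟨t.1, fun k => g (t.2 k)⟩

/-- The terms of a signature with variables in `X`. -/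
inductive Term (S : AlgSig.{u}) (X : Type u) : Type u
  | var (x : X) : Term S X
  | op (i : S.Op) (args : Fin (S.arity i) → Term S X) : Term S X

/-- The extension `f† : T X → Y` of `f : X → Y` to a homomorphism into the `Σ`-algebra `(Y, a)`. -/
def Term.fold {S : AlgSig.{u}} {X Y : Type u} (a : S.functor.obj Y → Y) (f : X → Y) :
    Term S X → Y
  | .var x => f x
  | .op i args => a ⟨i, fun k => Term.fold a f (args k)⟩

/-- The `Σ`-algebra structure `κ_X : Σ (T X) → T X` on terms. -/
def Term.node {S : AlgSig.{u}} {X : Type u} (t : S.functor.obj (Term S X)) : Term S X :=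
  .op t.1 t.2

/-- `f†` is the unique homomorphism from `(T X, κ_X)` to `(Y, a)` that extends `f`. -/
theorem Term.fold_unique {S : AlgSig.{u}} {X Y : Type u} (a : S.functor.obj Y → Y) (f : X → Y)
    (h : Term S X → Y) (hvar : ∀ x, h (.var x) = f x)
    (hop : ∀ i args, h (.op i args) = a ⟨i, fun k => h (args k)⟩) :
    h = Term.fold a f := by
  funext t
  induction t with
  | var x => exact hvar x
  | op i args ih =>
    rw [hop, Term.fold]
    congr 2
    funext k
    exact ih k

/-- A homomorphism of algebras after `f†` is again of the form `g†`. -/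
theorem Term.map_fold {S : AlgSig.{u}} {X Y W : Type u} (a : S.functor.obj Y → Y)
    (b : S.functor.obj W → W) (h : Y → W)
    (hh : ∀ i (args : Fin (S.arity i) → Y), h (a ⟨i, args⟩) = b ⟨i, fun k => h (args k)⟩)
    (f : X → Y) (t : Term S X) :
    h (Term.fold a f t) = Term.fold b (fun x => h (f x)) t := by
  refine congrFun (Term.fold_unique b (fun x => h (f x)) (fun t => h (Term.fold a f t))
    (fun _ => rfl) (fun i args => ?_)) t
  simp only [Term.fold, hh]

/-- Substitution of terms before `f†`. -/
theorem Term.fold_fold {S : AlgSig.{u}} {X Y W : Type u} (b : S.functor.obj W → W)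
    (g : X → Term S Y) (f : Y → W) (t : Term S X) :
    Term.fold b f (Term.fold Term.node g t) = Term.fold b (fun x => Term.fold b f (g x)) t :=
  Term.map_fold Term.node b (Term.fold b f) (fun _ _ => rfl) g t

theorem Term.fold_var {S : AlgSig.{u}} {X : Type u} (t : Term S X) :
    Term.fold Term.node Term.var t = t :=
  (congrFun (Term.fold_unique (Term.node (X := X)) Term.var id (fun _ => rfl)
    (fun _ _ => rfl)) t).symm

/-- The free monad `(T, η, μ)` over `Σ`: `T X` is the set of terms over `X`, `η` regards variables
as terms, and `μ` glues together terms built of terms. -/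
def freeMonad (S : AlgSig.{u}) : Monad (Type u) where
  obj X := Term S X
  map g := TypeCat.ofHom (Term.fold Term.node fun x => Term.var (g x))
  map_id X := by ext t; exact Term.fold_var t
  map_comp f g := by
    ext t
    exact (Term.fold_fold Term.node (fun x => Term.var (f x)) (fun y => Term.var (g y)) t).symm
  η := { app := fun X => TypeCat.ofHom Term.var }
  μ :=
    { app := fun X => TypeCat.ofHom (Term.fold Term.node id)
      naturality := fun X Y f => by
        ext t
        exact (Term.fold_fold _ _ _ t).trans
          (Term.map_fold Term.node Term.node (Term.fold Term.node fun x => Term.var (f x))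
            (fun _ _ => rfl) id t).symm }
  assoc X := by
    ext t
    exact (Term.fold_fold _ _ _ t).trans
      (Term.map_fold Term.node Term.node (Term.fold Term.node id) (fun _ _ => rfl) id t).symm
  left_unit X := rfl
  right_unit X := by
    ext t
    exact (Term.fold_fold _ _ _ t).trans (Term.fold_var t)

/-- The natural transformation `κ : Σ T ⟹ T`. -/
def kappa (S : AlgSig.{u}) : S.freeMonad.toFunctor ⋙ S.functor ⟶ S.freeMonad.toFunctor where
  app X := TypeCat.ofHom (Term.node (X := X))

end AlgSig

/-! ### Strength and costrength of endofunctors of `Set` -/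

/-- The strength `A × F X → F (A × X)`, `(a, t) ↦ F (x ↦ (a, x)) t`. -/
def strength (F : Type u ⥤ Type u) (A X : Type u) : A × F.obj X → F.obj (A × X) :=
  fun p => F.map (TypeCat.ofHom fun x => (p.1, x)) p.2

/-- The costrength `F (X ^ A) → (F X) ^ A`, `t ↦ (a ↦ F (f ↦ f a) t)`. -/
def costrength (F : Type u ⥤ Type u) (A X : Type u) : F.obj (A → X) → (A → F.obj X) :=
  fun t a => F.map (TypeCat.ofHom fun f => f a) t

/-- The functor `(-) ^ B`. -/
def power (B : Type u) : Type u ⥤ Type u where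
  obj X := B → X
  map g := TypeCat.ofHom fun f b => g (f b)

/-- The functor `F ^ B`, with `F ^ B X = (F X) ^ B`. -/
abbrev powerOf (F : Type u ⥤ Type u) (B : Type u) : Type u ⥤ Type u := F ⋙ power B

/-! ### Monadic specifications and the distributive laws that they induce -/

/-- A monadic abstract GSOS specification `λ : Σ F ⟹ F T` of `Σ` over `F`, where `T` is the free
monad over `Σ`. (`G ⋙ H` is the composite `H G`.) -/
abbrev MonadicSpec (S : AlgSig.{u}) (F : Type u ⥤ Type u) :=
  F ⋙ S.functor ⟶ S.freeMonad.toFunctor ⋙ F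

/-- A distributive law `ρ : T F ⟹ F T` of a monad `T` over a functor `F`. -/
structure DistribLaw (T : Monad (Type u)) (F : Type u ⥤ Type u) where
  /-- The natural transformation `T F ⟹ F T`. -/
  law : F ⋙ T.toFunctor ⟶ T.toFunctor ⋙ F
  unit : ∀ X, T.η.app (F.obj X) ≫ law.app X = F.map (T.η.app X)
  mult : ∀ X, T.μ.app (F.obj X) ≫ law.app X =
    T.map (law.app X) ≫ law.app (T.obj X) ≫ F.map (T.μ.app X)

namespace MonadicSpec

variable {S : AlgSig.{u}} {F : Type u ⥤ Type u}

/-- The `Σ`-algebra `F μ_X ∘ λ_{T X} : Σ F T X → F T X`. -/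
def alg (lam : MonadicSpec S F) (X : Type u) :
    S.functor.obj (F.obj (S.freeMonad.obj X)) → F.obj (S.freeMonad.obj X) :=
  fun t => F.map (S.freeMonad.μ.app X) (lam.app (S.freeMonad.obj X) t)

theorem alg_natural (lam : MonadicSpec S F) {X Y : Type u}
    (g : S.freeMonad.obj X ⟶ S.freeMonad.obj Y)
    (hg : S.freeMonad.μ.app X ≫ g = S.freeMonad.map g ≫ S.freeMonad.μ.app Y)
    (t : S.functor.obj (F.obj (S.freeMonad.obj X))) :
    F.map g (lam.alg X t) = lam.alg Y (S.functor.map (F.map g) t) := by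
  have h := ConcreteCategory.congr_hom (lam.naturality g) t
  simp only [Functor.comp_map, types_comp_apply] at h
  simp only [alg, h]
  generalize lam.app (S.freeMonad.obj X) t = v
  rw [← types_comp_apply, ← types_comp_apply, ← F.map_comp, ← F.map_comp, hg]

/-- The distributive law `ρ : T F ⟹ F T` induced by `λ : Σ F ⟹ F T`: its component at `X` is the
homomorphism that extends `F η_X` along the algebra `F μ_X ∘ λ_{T X}`. -/
def distribLaw (lam : MonadicSpec S F) : DistribLaw S.freeMonad F where
  law :=
    { app := fun X => TypeCat.ofHom (AlgSig.Term.fold (lam.alg X) (F.map (S.freeMonad.η.app X)))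
      naturality := fun X Y f => by
        ext t
        refine (AlgSig.Term.fold_fold _ _ _ t).trans (Eq.trans ?_
          (AlgSig.Term.map_fold (lam.alg X) (lam.alg Y) (F.map (S.freeMonad.map f))
            (fun i args => lam.alg_natural (S.freeMonad.map f)
              (S.freeMonad.μ.naturality f).symm ⟨i, args⟩) _ t).symm)
        congr 1
        funext x
        change F.map (S.freeMonad.η.app Y) (F.map f x) = _
        rw [← types_comp_apply, ← types_comp_apply, ← F.map_comp, ← F.map_comp,
          S.freeMonad.unit_naturality] }
  unit X := rfl
  mult X := by
    ext t
    refine (AlgSig.Term.fold_fold _ _ _ t).trans (Eq.symm ?_)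
    have key := AlgSig.Term.map_fold (lam.alg (S.freeMonad.obj X)) (lam.alg X)
      (F.map (S.freeMonad.μ.app X))
      (fun i args => lam.alg_natural (S.freeMonad.μ.app X) (S.freeMonad.assoc X).symm ⟨i, args⟩)
      (F.map (S.freeMonad.η.app (S.freeMonad.obj X)))
    refine (key _).trans ((AlgSig.Term.fold_fold _ _ _ t).trans ?_)
    congr 1
    funext x
    change F.map (S.freeMonad.μ.app X) (F.map (S.freeMonad.η.app (S.freeMonad.obj X)) _) = _
    rw [← types_comp_apply, ← F.map_comp, S.freeMonad.left_unit, F.map_id]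
    rfl

/-- The induced distributive law `ρ` restricts to `λ`, that is, `ρ ∘ κ_F ∘ Σ η_F = λ`. -/
theorem distribLaw_restrict (lam : MonadicSpec S F) (X : Type u) :
    S.functor.map (S.freeMonad.η.app (F.obj X)) ≫ S.kappa.app (F.obj X) ≫
      lam.distribLaw.law.app X = lam.app X := by
  ext t
  change F.map (S.freeMonad.μ.app X) (lam.app (S.freeMonad.obj X)
    (S.functor.map (F.map (S.freeMonad.η.app X)) t)) = _
  have h := ConcreteCategory.congr_hom (lam.naturality (S.freeMonad.η.app X)) t
  simp only [Functor.comp_map, types_comp_apply] at h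
  rw [h, ← types_comp_apply, ← F.map_comp, S.freeMonad.right_unit, F.map_id]
  rfl

/-- The induced distributive law is the only one that restricts to `λ`. -/
theorem distribLaw_unique (lam : MonadicSpec S F) (ρ : DistribLaw S.freeMonad F)
    (h : ∀ X, S.functor.map (S.freeMonad.η.app (F.obj X)) ≫ S.kappa.app (F.obj X) ≫
      ρ.law.app X = lam.app X) : ρ.law = lam.distribLaw.law := by
  ext X t
  refine congrFun (AlgSig.Term.fold_unique (lam.alg X) (F.map (S.freeMonad.η.app X))
    (ρ.law.app X) (fun x => ConcreteCategory.congr_hom (ρ.unit X) x) (fun i args => ?_)) t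
  let T2 : S.Term (S.Term (F.obj X)) := .op i fun k => .var (args k)
  have hm := ConcreteCategory.congr_hom (ρ.mult X) T2
  refine hm.trans ?_
  exact congrArg (F.map (S.freeMonad.μ.app X)) (ConcreteCategory.congr_hom
    (h (S.freeMonad.obj X)) ⟨i, fun k => ρ.law.app X (args k)⟩)

/-- The abstract semantics `T Z → Z`: the coinductive extension of the coalgebra
`T Z → T F Z → F T Z` given by the induced distributive law, for a final `F`-coalgebra `Z`. -/
def abstractSem (lam : MonadicSpec S F) {Z : Endofunctor.Coalgebra F}
    (hZ : Limits.IsTerminal Z) : S.freeMonad.obj Z.V ⟶ Z.V :=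
  (hZ.from ⟨S.freeMonad.obj Z.V, S.freeMonad.map Z.str ≫ lam.distribLaw.law.app Z.V⟩).f

/-- The `Σ`-algebra `Σ Z → Σ T Z → T Z → Z` induced by `λ` on a final `F`-coalgebra `Z`. -/
def inducedAlg (lam : MonadicSpec S F) {Z : Endofunctor.Coalgebra F}
    (hZ : Limits.IsTerminal Z) : S.functor.obj Z.V ⟶ Z.V :=
  S.functor.map (S.freeMonad.η.app Z.V) ≫ S.kappa.app Z.V ≫ lam.abstractSem hZ

/-- The monadic specification `λ̄ : Σ (F ^ B) ⟹ (F T) ^ B = F ^ B T` obtained from `λ` by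
costrength: `Σ ((F X) ^ B) → (Σ F X) ^ B → (F T X) ^ B`. -/
def extend (lam : MonadicSpec S F) (B : Type u) : MonadicSpec S (powerOf F B) where
  app X := TypeCat.ofHom (costrength S.functor B (F.obj X)) ≫ (power B).map (lam.app X)
  naturality X Y f := by
    ext t
    funext b
    exact ConcreteCategory.congr_hom (lam.naturality f)
      (costrength S.functor B (F.obj X) t b)

end MonadicSpec

/-! ### Pointwise extensions -/

/-- For `s : Y → B × Y` and `m : X → (F X) ^ B`, the `F`-coalgebra `s ⋉ m` on `Y × X`:
`(y, x) ↦ st (y', m x b)`, where `s y = (b, y')`. -/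
def ltimes {F : Type u ⥤ Type u} {B Y X : Type u} (s : Y → B × Y) (m : X → (B → F.obj X)) :
    Y × X → F.obj (Y × X) :=
  fun p => strength F Y X ((s p.1).2, m p.2 (s p.1).1)

/-- The evaluation `ev : B^ω × Z̄ → Z`: the coinductive extension of `⟨hd, tl⟩ ⋉ ζ̄`, where `Z` is a
final `F`-coalgebra. -/
def ev {F : Type u ⥤ Type u} {B : Type u} {Z : Endofunctor.Coalgebra F}
    (hZ : Limits.IsTerminal Z) (Zb : Endofunctor.Coalgebra (powerOf F B)) :
    Stream' B × Zb.V ⟶ Z.V :=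
  (hZ.from ⟨Stream' B × Zb.V,
    TypeCat.ofHom (ltimes (fun β : Stream' B => (β.head, β.tail)) Zb.str)⟩).f

/-- `σ̄ : Σ Z̄ → Z̄` is a pointwise extension of `σ : Σ Z → Z`, where `Z` and `Z̄` are final
coalgebras of `F` and `F ^ B`:  `ev ∘ (id × σ̄) = σ ∘ Σ ev ∘ st` as maps `B^ω × Σ Z̄ → Z`. -/
def IsPointwiseExtension (S : AlgSig.{u}) {F : Type u ⥤ Type u} {B : Type u}
    {Z : Endofunctor.Coalgebra F} (hZ : Limits.IsTerminal Z)
    (Zb : Endofunctor.Coalgebra (powerOf F B))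
    (σb : S.functor.obj Zb.V ⟶ Zb.V) (σ : S.functor.obj Z.V ⟶ Z.V) : Prop :=
  ∀ (β : Stream' B) (t : S.functor.obj Zb.V),
    ev hZ Zb (β, σb t) =
      σ (S.functor.map (ev hZ Zb) (strength S.functor (Stream' B) Zb.V (β, t)))

end CoalgExt

/-!
Write `⟦-⟧` for the abstract semantics `T Z → Z` of `lam`, `⟦-⟧ᴮ` for the semantics
`T Z̄ → Z̄` of `lam.extend B`, and `ev_β` for `ev (β, -) : Z̄ → Z`. The statement about operations is
the case of depth-one terms of a statement about all terms:
`ev_β ⟦t⟧ᴮ = ⟦T ev_β t⟧` for all streams `β` and all `t : T Z̄` (`ev_abstractSem`).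

Both sides are shown to be coalgebra morphisms into the final `F`-coalgebra `Z` from one coalgebra
on `B^ω × T Z̄`, namely `⟨hd, tl⟩ ⋉ (ρ̄ ∘ T ζ̄)`, where `ρ̄` is the distributive law of
`lam.extend B`. The left side is one because `⟦-⟧ᴮ` is a morphism of `F ^ B`-coalgebras. For the
right side the point is that `ρ̄` is computed pointwise from the distributive law `ρ` of `lam`:
`ρ̄ t b = ρ (T (f ↦ f b) t)` (`distribLaw_extend_apply`). With it, naturality of `ρ` and the
defining equation `ζ ∘ ev_β = F ev_{tl β} ∘ (ζ̄ (-) (hd β))` give the claim.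
-/

namespace CoalgExt

/-- The defining equation of `ev`, read at a fixed stream `β`:
`ζ ∘ ev_β = F ev_{tl β} ∘ (ζ̄ (-) (hd β))`. -/
theorem str_ev {F : Type u ⥤ Type u} {B : Type u} {Z : Endofunctor.Coalgebra F}
    (hZ : Limits.IsTerminal Z) (Zb : Endofunctor.Coalgebra (powerOf F B))
    (β : Stream' B) (z : Zb.V) :
    Z.str (ev hZ Zb (β, z)) =
      F.map (TypeCat.ofHom fun z' => ev hZ Zb (β.tail, z')) (Zb.str z β.head) := by
  have h := ConcreteCategory.congr_hom (hZ.from ⟨Stream' B × Zb.V,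
    TypeCat.ofHom (ltimes (fun β : Stream' B => (β.head, β.tail)) Zb.str)⟩).h
    ((β, z) : Stream' B × Zb.V)
  refine h.symm.trans ?_
  change F.map (ev hZ Zb) (F.map _ _) = _
  rw [← types_comp_apply, ← F.map_comp]
  rfl

namespace MonadicSpec

variable {S : AlgSig.{u}} {F : Type u ⥤ Type u}

/-- The distributive law induced by `lam.extend B` is that of `lam`, computed pointwise:
evaluation at `b` is a homomorphism between the algebras that define the two laws. -/
theorem distribLaw_extend_apply (lam : MonadicSpec S F) (B X : Type u)
    (t : S.freeMonad.obj (B → F.obj X)) (b : B) :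
    (lam.extend B).distribLaw.law.app X t b =
      lam.distribLaw.law.app X (S.freeMonad.map (TypeCat.ofHom fun f : B → F.obj X => f b) t) := by
  refine (AlgSig.Term.map_fold ((lam.extend B).alg X) (lam.alg X)
    (fun f : B → F.obj (S.freeMonad.obj X) => f b) (fun _ _ => rfl) _ t).trans ?_
  exact (AlgSig.Term.fold_fold (lam.alg X) (fun f : B → F.obj X => .var (f b))
    (F.map (S.freeMonad.η.app X)) t).symm

theorem str_abstractSem (lam : MonadicSpec S F) {Z : Endofunctor.Coalgebra F}
    (hZ : Limits.IsTerminal Z) (t : S.freeMonad.obj Z.V) :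
    Z.str (lam.abstractSem hZ t) =
      F.map (lam.abstractSem hZ) (lam.distribLaw.law.app Z.V (S.freeMonad.map Z.str t)) :=
  (ConcreteCategory.congr_hom (hZ.from ⟨S.freeMonad.obj Z.V,
    S.freeMonad.map Z.str ≫ lam.distribLaw.law.app Z.V⟩).h t).symm

/-- The abstract semantics of `lam.extend B` is the pointwise extension of that of `lam`, on terms
of any depth. -/
theorem ev_abstractSem (lam : MonadicSpec S F) {B : Type u} {Z : Endofunctor.Coalgebra F}
    (hZ : Limits.IsTerminal Z) {Zb : Endofunctor.Coalgebra (powerOf F B)}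
    (hZb : Limits.IsTerminal Zb) (β : Stream' B) (t : S.freeMonad.obj Zb.V) :
    ev hZ Zb (β, (lam.extend B).abstractSem hZb t) =
      lam.abstractSem hZ (S.freeMonad.map (TypeCat.ofHom fun z => ev hZ Zb (β, z)) t) := by
  let m : S.freeMonad.obj Zb.V → (B → F.obj (S.freeMonad.obj Zb.V)) :=
    S.freeMonad.map Zb.str ≫ (lam.extend B).distribLaw.law.app Zb.V
  let C : Endofunctor.Coalgebra F := ⟨Stream' B × S.freeMonad.obj Zb.V,
    TypeCat.ofHom (ltimes (fun β : Stream' B => (β.head, β.tail)) m)⟩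
  let f₁ : C ⟶ Z :=
    { f := TypeCat.ofHom fun p => ev hZ Zb (p.1, (lam.extend B).abstractSem hZb p.2)
      h := by
        ext ⟨β, t⟩
        change F.map _ (F.map _ (m t β.head)) = Z.str (ev hZ Zb (β, _))
        have h := congrFun ((lam.extend B).str_abstractSem hZb t) β.head
        rw [str_ev, h, ← types_comp_apply, ← F.map_comp]
        change _ = F.map _ (F.map ((lam.extend B).abstractSem hZb) (m t β.head))
        rw [← types_comp_apply (F.map _), ← F.map_comp]
        rfl }
  let f₂ : C ⟶ Z :=
    { f := TypeCat.ofHom fun p =>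
        lam.abstractSem hZ (S.freeMonad.map (TypeCat.ofHom fun z => ev hZ Zb (p.1, z)) p.2)
      h := by
        ext ⟨β, t⟩
        let e (β : Stream' B) : Zb.V ⟶ Z.V := TypeCat.ofHom fun z => ev hZ Zb (β, z)
        let d : Zb.V ⟶ F.obj Zb.V := TypeCat.ofHom fun z => Zb.str z β.head
        have he : e β ≫ Z.str = d ≫ F.map (e β.tail) := by
          ext z
          exact str_ev hZ Zb β z
        have hm : m t β.head = lam.distribLaw.law.app Zb.V (S.freeMonad.map d t) := by
          refine (lam.distribLaw_extend_apply B Zb.V (S.freeMonad.map Zb.str t) β.head).trans ?_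
          exact congrArg (lam.distribLaw.law.app Zb.V) (Functor.map_comp_apply
            S.freeMonad.toFunctor Zb.str
            (TypeCat.ofHom fun f : B → F.obj Zb.V => f β.head) t).symm
        -- naturality of `ρ` at `ev_{tl β}` moves `ev` past the distributive law
        have hn : lam.distribLaw.law.app Z.V (S.freeMonad.map Z.str (S.freeMonad.map (e β) t)) =
            F.map (S.freeMonad.map (e β.tail)) (m t β.head) := by
          rw [← Functor.map_comp_apply, he, Functor.map_comp_apply, hm]
          exact ConcreteCategory.congr_hom (lam.distribLaw.law.naturality (e β.tail))
            (S.freeMonad.map d t)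
        change F.map _ (F.map _ (m t β.head)) =
          Z.str (lam.abstractSem hZ (S.freeMonad.map (e β) t))
        rw [str_abstractSem, hn, ← types_comp_apply (F.map _), ← F.map_comp,
          ← types_comp_apply (F.map _), ← F.map_comp]
        rfl }
  exact ConcreteCategory.congr_hom
    (congrArg Endofunctor.Coalgebra.Hom.f (hZ.hom_ext f₁ f₂))
    ((β, t) : Stream' B × S.freeMonad.obj Zb.V)

end MonadicSpec

end CoalgExt

theorem mainTheorem6 (S : CoalgExt.AlgSig.{u}) (F : Type u ⥤ Type u) (B : Type u)
    (Z : Endofunctor.Coalgebra F) (hZ : Limits.IsTerminal Z)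
    (Zb : Endofunctor.Coalgebra (CoalgExt.powerOf F B)) (hZb : Limits.IsTerminal Zb)
    (lam : CoalgExt.MonadicSpec S F) :
    CoalgExt.IsPointwiseExtension S hZ Zb
      (CoalgExt.MonadicSpec.inducedAlg (lam.extend B) hZb)
      (CoalgExt.MonadicSpec.inducedAlg lam hZ) :=
  -- the depth-one term `κ (Σ η t)`
  fun β t => lam.ev_abstractSem hZ hZb β (.op t.1 fun k => .var (t.2 k))
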